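/- Let $\mu$ be a nonzero finite Borel measure on $\mathbb{R}^d$. Its convex core $\mathrm{cc}(\mu)$ is the intersection of all convex Borel sets $C\subseteq\mathbb{R}^d$ with $\mu(C)=\mu(\mathbb{R}^d)$. A face of $\mathrm{cc}(\mu)$ is a nonempty convex subset $F\subseteq\mathrm{cc}(\mu)$ such that whenever $tx+(1-t)y\in F$ with $x,y\in\mathrm{cc}(\mu)$ and $0<t<1$, both $x$ and $y$ lie in $F$. For a face $F$ of $\mathrm{cc}(\mu)$ let $\mathcal{E}^F$ be the set of all probability measures $Q_{F,\vartheta}$ with density $$\frac{e^{\langle\vartheta,x\rangle}}{\int_{\mathrm{cl}(F)}e^{\langle\vartheta,z\rangle}\,\mu(dz)}$$ with respect to the restriction of $\mu$ to $\mathrm{cl}(F)$, where $\vartheta$ ranges over all vectors in $\mathbb{R}^d$ for which the integral is finite. Let $\mathcal{E}$ be the full exponential family based on $\mu$, that is, the set of all probability measures with $\mu$-density $e^{\langle\vartheta,x\rangle}/\int_{\mathbb{R}^d}e^{\langle\vartheta,z\rangle}\,\mu(dz)$ for $\vartheta\in\mathbb{R}^d$ with finite integral, and let its extension $\mathrm{ext}(\mathcal{E})$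 be the union of the components $\mathcal{E}^F$ over all faces $F$ of $\mathrm{cc}(\mu)$. **Theorem.** Let $(Q_n)$ be a sequence in $\mathrm{ext}(\mathcal{E})$ and $P$ a probability measure on $\mathbb{R}^d$ such that $Q_n$ converges to $P$ in variation distance, that is, the total variation $|Q_n-P|$ goes to zero. Then there is a face $F$ of $\mathrm{cc}(\mu)$ such that 1. $P\in\mathcal{E}^F$; 2. for all sufficiently large $n$, the face $F_n$ of $\mathrm{cc}(\mu)$ with $Q_n\in\mathcal{E}^{F_n}$ contains $F$; 3. for all sufficiently large $n$, $Q_n(\mathrm{cl}(F))>0$ and the conditioned probability measure $Q_n(\cdot\mid\mathrm{cl}(F))=Q_n(\cdot\cap\mathrm{cl}(F))/Q_n(\mathrm{cl}(F))$ belongs to $\mathcal{E}^F$; 4. the probability measures $Q_n(\cdot\mid\mathrm{cl}(F))$ (defined for large $n$) converge to $P$ in variation distance. -/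

import Mathlib

open MeasureTheory ProbabilityTheory Filter Topology

open scoped ENNReal

noncomputable section

/-- The convex core of a measure on Euclidean space: the intersection of all convex Borel sets of
full measure. -/
def convexCore {d : ℕ} (μ : Measure (EuclideanSpace ℝ (Fin d))) :
    Set (EuclideanSpace ℝ (Fin d)) :=
  ⋂₀ {C | Convex ℝ C ∧ MeasurableSet C ∧ μ C = μ Set.univ}

/-- `F` is a face of the convex set `C`: a nonempty convex subset of `C` such that whenever a point
`t • x + (1 - t) • y` with `x, y ∈ C` and `0 < t < 1` lies in `F`, both `x` and `y` lie in `F`. -/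
def IsConvexFace {d : ℕ} (C F : Set (EuclideanSpace ℝ (Fin d))) : Prop :=
  F.Nonempty ∧ Convex ℝ F ∧ IsExtreme ℝ C F

/-- The full exponential family based on `ν`, with the identity as canonical statistic. The
canonical parameter `ϑ` ranges over all vectors with `∫ exp ⟪ϑ, x⟫ ∂ν < ∞`, and `ν.tilted` has the
`ν`-density `exp ⟪ϑ, x⟫ / ∫ exp ⟪ϑ, x⟫ ∂ν = exp (⟪ϑ, x⟫ - Λ(ϑ))`, where
`Λ(ϑ) = log ∫ exp ⟪ϑ, x⟫ ∂ν`. -/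
def expFamily {d : ℕ} (ν : Measure (EuclideanSpace ℝ (Fin d))) :
    Set (Measure (EuclideanSpace ℝ (Fin d))) :=
  {Q | ∃ ϑ : EuclideanSpace ℝ (Fin d),
    Integrable (fun x => Real.exp (inner ℝ ϑ x)) ν ∧ Q = ν.tilted (fun x => inner ℝ ϑ x)}

/-- The component for `F`: the exponential family based on the restriction of `μ` to the closure
of `F`. -/
def expComponent {d : ℕ} (μ : Measure (EuclideanSpace ℝ (Fin d)))
    (F : Set (EuclideanSpace ℝ (Fin d))) : Set (Measure (EuclideanSpace ℝ (Fin d))) :=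
  expFamily (μ.restrict (closure F))

/-- The extension of the exponential family based on `μ`: the union of the components over all
faces of the convex core of `μ`. -/
def expExtension {d : ℕ} (μ : Measure (EuclideanSpace ℝ (Fin d))) :
    Set (Measure (EuclideanSpace ℝ (Fin d))) :=
  {Q | ∃ F, IsConvexFace (convexCore μ) F ∧ Q ∈ expComponent μ F}

/-- The variation distance of two finite measures: the total variation of their difference. -/
def variationDist {d : ℕ} (P Q : Measure (EuclideanSpace ℝ (Fin d)))
    [IsFiniteMeasure P] [IsFiniteMeasure Q] : ℝ≥0∞ :=
  (P.toSignedMeasure - Q.toSignedMeasure).totalVariation Set.univ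

/-- Conditionings of finite measures are finite (the zero measure if `Q s = 0`). -/
instance isFiniteMeasure_cond {d : ℕ} (Q : Measure (EuclideanSpace ℝ (Fin d)))
    [IsFiniteMeasure Q] (s : Set (EuclideanSpace ℝ (Fin d))) : IsFiniteMeasure (cond Q s) := by
  by_cases h : Q s = 0
  · rw [cond_eq_zero_of_meas_eq_zero h]
    infer_instance
  · have := cond_isProbabilityMeasure h
    infer_instance

end

/-! The face `F` is the smallest face of the core of `μ` containing a relative interior point `x` of
the core of `P`. The core of `P` then lies in `F`, so `P` is carried by `closure F`.

A point of a core lies in every convex Borel set of almost full measure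
(`exists_forall_mem_of_measure_compl_lt`). Applied to `x` and `P`, this puts `x` in the core of the
base measure of `Q n` for large `n`, hence in the face of `Q n`, which contains `F` by minimality.
Conditioning on `closure F` then gives members of the component of `F` that still converge to `P`.

To identify `P`, pass to a subsequence whose densities converge a.e. Their logarithms are affine, so
the points where the densities converge form a convex set `D`, in which the points with positive
limit form an extreme convex set `S`. The core of the base measure lies in `D`, and `x` lies in `S`;
minimality of `F` forces `F ⊆ S`. The log densities therefore converge on `F`, hence on its closure,
to an affine function. This uses that `F` lies in the core of `μ` restricted to `closure F`
(`subset_convexCore_restrict_closure`). -/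

/-! ### Separation and faces in finite dimension. -/

section ConvexGeometry

variable {E : Type*} [NormedAddCommGroup E] [InnerProductSpace ℝ E] [FiniteDimensional ℝ E]

/-- Proper separation of a point from a convex set in finite dimension: the point may belong to the
set, provided it is not in the relative interior. -/
theorem exists_inner_nonpos_of_forall_notMem_openSegment {C : Set E} (hC : Convex ℝ C) {x y : E}
    (hy : y ∈ C) (h : ∀ c ∈ C, x ∉ openSegment ℝ y c) :
    ∃ u : E, (∀ c ∈ C, inner ℝ u (c - x) ≤ 0) ∧ ∃ w ∈ C, inner ℝ u (w - x) < 0 := by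
  -- Inside the span of `C - x`, the cone `K` over `C - x` has interior points, where the separating
  -- functional is strictly negative.
  set V : Submodule ℝ E := Submodule.span ℝ ((fun c => c - x) '' C) with hV
  have hmem : ∀ c ∈ C, c - x ∈ V := fun c hc => Submodule.subset_span ⟨c, hc, rfl⟩
  set K : Set V := {k | ∃ t : ℝ, 0 < t ∧ ∃ c ∈ C, (k : E) = t • (c - x)} with hK
  have hsmul : ∀ k ∈ K, ∀ s : ℝ, 0 < s → s • k ∈ K := by
    rintro k ⟨t, ht, c, hc, hk⟩ s hs
    exact ⟨s * t, mul_pos hs ht, c, hc, by rw [Submodule.coe_smul, hk, smul_smul]⟩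
  have hKconv : Convex ℝ K := by
    rw [convex_iff_forall_pos]
    rintro k₁ ⟨t₁, ht₁, c₁, hc₁, hk₁⟩ k₂ ⟨t₂, ht₂, c₂, hc₂, hk₂⟩ a b ha hb -
    have h1 : 0 < a * t₁ := mul_pos ha ht₁
    have h2 : 0 < b * t₂ := mul_pos hb ht₂
    have h3 : 0 < a * t₁ + b * t₂ := add_pos h1 h2
    refine ⟨a * t₁ + b * t₂, h3, _, hC hc₁ hc₂ (div_pos h1 h3).le (div_pos h2 h3).le
      (by field_simp), ?_⟩
    rw [Submodule.coe_add, Submodule.coe_smul, Submodule.coe_smul, hk₁, hk₂]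
    match_scalars <;> field_simp
    ring
  have hKmem : ∀ c (hc : c ∈ C), (⟨c - x, hmem c hc⟩ : V) ∈ K := fun c hc =>
    ⟨1, one_pos, c, hc, by simp⟩
  have hspan : Submodule.span ℝ K = ⊤ := by
    rw [eq_top_iff]
    rintro ⟨v, hv⟩ -
    induction hv using Submodule.span_induction with
    | mem v hv => obtain ⟨c, hc, rfl⟩ := hv; exact Submodule.subset_span (hKmem c hc)
    | zero => exact Submodule.zero_mem _
    | add v w hv hw hv' hw' => exact Submodule.add_mem _ hv' hw'
    | smul a v hv hv' => exact Submodule.smul_mem _ a hv'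
  have hint : (interior K).Nonempty := by
    rw [hKconv.interior_nonempty_iff_affineSpan_eq_top,
      AffineSubspace.affineSpan_eq_top_iff_vectorSpan_eq_top_of_nonempty ℝ V V ⟨_, hKmem y hy⟩,
      eq_top_iff, ← hspan, Submodule.span_le]
    intro k hk
    have := vsub_mem_vectorSpan ℝ (hsmul k hk 2 two_pos) hk
    rwa [vsub_eq_sub, two_smul, add_sub_cancel_right] at this
  have h0 : (0 : V) ∉ interior K := by
    intro h0
    -- If `0` were interior, a small negative multiple of `y - x` would lie in `K`, placing `x`
    -- strictly between `y` and some `c ∈ C`.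
    have ht : Tendsto (fun ε : ℝ => (-ε) • (⟨y - x, hmem y hy⟩ : V)) (𝓝[>] 0) (𝓝 0) := by
      have : Continuous (fun ε : ℝ => (-ε) • (⟨y - x, hmem y hy⟩ : V)) := by fun_prop
      have := this.tendsto 0
      simp only [neg_zero, zero_smul] at this
      exact this.mono_left nhdsWithin_le_nhds
    obtain ⟨ε, ⟨t, ht, c, hc, hk⟩, hε⟩ :=
      ((ht.eventually (mem_interior_iff_mem_nhds.1 h0)).and self_mem_nhdsWithin).exists
    have hε : 0 < ε := hε
    refine h c hc ⟨ε / (ε + t), t / (ε + t), by positivity, by positivity, by field_simp, ?_⟩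
    have hk : (-ε) • (y - x) = t • (c - x) := hk
    have : ε • y + t • c = (ε + t) • x := by
      rw [← sub_eq_zero] at hk ⊢
      rw [← neg_eq_zero, ← hk]; module
    rw [div_eq_inv_mul, div_eq_inv_mul, mul_smul, mul_smul, ← smul_add, this,
      inv_smul_smul₀ (by positivity)]
  obtain ⟨f, hf⟩ := geometric_hahn_banach_open_point hKconv.interior isOpen_interior h0
  rw [map_zero] at hf
  have hle : ∀ k ∈ K, f k ≤ 0 := by
    intro k hk
    have hk' : k ∈ closure (interior K) := by
      rw [hKconv.closure_interior_eq_closure_of_nonempty_interior hint]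
      exact subset_closure hk
    exact closure_minimal (fun a ha => (hf a ha).le)
      (isClosed_le f.continuous continuous_const) hk'
  obtain ⟨u, hu⟩ := (InnerProductSpace.toDual ℝ V).surjective f
  have hfu : ∀ k : V, f k = inner ℝ (u : E) (k : E) := by
    intro k
    rw [← hu, InnerProductSpace.toDual_apply_apply, Submodule.coe_inner]
  refine ⟨u, fun c hc => ?_, ?_⟩
  · rw [← hfu ⟨c - x, hmem c hc⟩]; exact hle _ (hKmem c hc)
  · obtain ⟨k, hk⟩ := hint
    obtain ⟨t, ht, c, hc, hkc⟩ := interior_subset hk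
    refine ⟨c, hc, ?_⟩
    have := hf k hk
    rw [hfu, hkc, inner_smul_right] at this
    exact (pos_iff_neg_of_mul_neg this).1 ht

/-- The line from `y` through `x` can be prolonged slightly beyond `x` without leaving `C`. -/
theorem exists_mem_openSegment_of_mem_intrinsicInterior {E : Type*} [NormedAddCommGroup E]
    [InnerProductSpace ℝ E] {C : Set E} {x y : E}
    (hx : x ∈ intrinsicInterior ℝ C) (hy : y ∈ affineSpan ℝ C) :
    ∃ z ∈ C, x ∈ openSegment ℝ y z := by
  obtain ⟨x, hxC, rfl⟩ := mem_intrinsicInterior.1 hx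
  let g : ℝ → affineSpan ℝ C := fun ε =>
    ⟨AffineMap.lineMap (x : E) y (-ε), AffineMap.lineMap_mem _ x.2 hy⟩
  have hg : Continuous g :=
    Continuous.subtype_mk (AffineMap.lineMap_continuous.comp continuous_neg) _
  have hg0 : g 0 = x := by ext; simp [g]
  have ht : Tendsto g (𝓝[>] 0) (𝓝 x) := by
    have := hg.tendsto 0
    rw [hg0] at this
    exact this.mono_left nhdsWithin_le_nhds
  obtain ⟨ε, hgε, hε⟩ :=
    ((ht.eventually (mem_interior_iff_mem_nhds.1 hxC)).and self_mem_nhdsWithin).exists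
  have hε : 0 < ε := hε
  refine ⟨g ε, hgε, ε / (ε + 1), 1 / (ε + 1), by positivity, by positivity, by field_simp, ?_⟩
  have : ε • y + (1 : ℝ) • (g ε : E) = (ε + 1) • (x : E) := by
    simp only [g, AffineMap.lineMap_apply_module]; module
  rw [div_eq_inv_mul, div_eq_inv_mul, mul_smul, mul_smul, ← smul_add, this,
    inv_smul_smul₀ (by positivity)]

/-- A face of a convex set is its intersection with the closure of the face. -/
theorem IsExtreme.mem_of_mem_closure {C F : Set E} (hF : IsExtreme ℝ C F) (hconv : Convex ℝ F)
    {y : E} (hyC : y ∈ C) (hyF : y ∈ closure F) : y ∈ F := by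
  obtain ⟨x, hx⟩ := Set.Nonempty.intrinsicInterior hconv (closure_nonempty_iff.1 ⟨y, hyF⟩)
  have hy : y ∈ affineSpan ℝ F :=
    closure_minimal (subset_affineSpan ℝ F)
      (AffineSubspace.closed_of_finiteDimensional _) hyF
  obtain ⟨z, hz, hxz⟩ := exists_mem_openSegment_of_mem_intrinsicInterior hx hy
  exact hF.2 hyC (hF.1 hz) (intrinsicInterior_subset hx) hxz

end ConvexGeometry

/-! ### The convex core and its faces. -/

section ConvexCore

variable {d : ℕ}

theorem mem_convexCore_iff {μ : Measure (EuclideanSpace ℝ (Fin d))} [IsFiniteMeasure μ]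
    {x : EuclideanSpace ℝ (Fin d)} :
    x ∈ convexCore μ ↔ ∀ C, Convex ℝ C → MeasurableSet C → (∀ᵐ y ∂μ, y ∈ C) → x ∈ C := by
  simp only [convexCore, Set.mem_sInter, Set.mem_ofPred_eq, and_imp]
  refine forall₃_congr fun C _ hm => ?_
  rw [ae_mem_iff_measure_eq hm.nullMeasurableSet]

theorem convex_convexCore (μ : Measure (EuclideanSpace ℝ (Fin d))) : Convex ℝ (convexCore μ) :=
  convex_sInter fun _ hC => hC.1

theorem convexCore_mono {μ ν : Measure (EuclideanSpace ℝ (Fin d))} [IsFiniteMeasure μ]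
    [IsFiniteMeasure ν] (h : ν ≪ μ) : convexCore ν ⊆ convexCore μ := by
  intro x hx
  rw [mem_convexCore_iff] at hx ⊢
  exact fun C hC hm hae => hx C hC hm (h.ae_le hae)

/-- The point is a barycenter of `μ`. The weight `(1 + ‖y‖)⁻¹` is there because `μ` need not have a
first moment. -/
theorem exists_forall_ae_inner_eq_zero (μ : Measure (EuclideanSpace ℝ (Fin d)))
    [IsFiniteMeasure μ] [NeZero μ] :
    ∃ x : EuclideanSpace ℝ (Fin d), ∀ u : EuclideanSpace ℝ (Fin d),
      (∀ᵐ y ∂μ, inner ℝ u (y - x) ≤ 0) → ∀ᵐ y ∂μ, inner ℝ u (y - x) = 0 := by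
  set g : EuclideanSpace ℝ (Fin d) → ℝ := fun y => (1 + ‖y‖)⁻¹ with hg
  have hgpos : ∀ y, 0 < g y := fun y => by positivity
  have hgc : Continuous g :=
    (continuous_const.add continuous_norm).inv₀ fun y => (by positivity : 0 < 1 + ‖y‖).ne'
  have hgi : Integrable g μ := by
    refine Integrable.of_bound hgc.aestronglyMeasurable 1 (ae_of_all _ fun y => ?_)
    rw [Real.norm_of_nonneg (hgpos y).le]
    exact inv_le_one_of_one_le₀ (by linarith [norm_nonneg y])
  have hgyi : Integrable (fun y => g y • y) μ := by
    refine Integrable.of_bound (hgc.smul continuous_id).aestronglyMeasurable 1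
      (ae_of_all _ fun y => ?_)
    rw [norm_smul, Real.norm_of_nonneg (hgpos y).le, hg, inv_mul_le_iff₀ (by positivity)]
    linarith
  have hI : 0 < ∫ y, g y ∂μ := by
    rw [integral_pos_iff_support_of_nonneg (fun y => (hgpos y).le) hgi,
      Function.support_eq_univ fun y => (hgpos y).ne']
    exact NeZero.pos _
  refine ⟨(∫ y, g y ∂μ)⁻¹ • ∫ y, g y • y ∂μ, fun u hu => ?_⟩
  set x := (∫ y, g y ∂μ)⁻¹ • ∫ y, g y • y ∂μ with hx
  have hint : Integrable (fun y => g y • y - g y • x) μ := hgyi.sub (hgi.smul_const x)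
  have h0 : ∫ y, g y • y - g y • x ∂μ = 0 := by
    rw [integral_sub hgyi (hgi.smul_const x), integral_smul_const, hx, smul_inv_smul₀ hI.ne',
      sub_self]
  have hinner : ∫ y, -inner ℝ u (g y • y - g y • x) ∂μ = 0 := by
    rw [integral_neg, integral_inner hint, h0, inner_zero_right, neg_zero]
  have hinner := (integral_eq_zero_iff_of_nonneg_ae ?_ (hint.const_inner u).neg).1 hinner
  · filter_upwards [hinner] with y hy
    have hy : -inner ℝ u (g y • y - g y • x) = 0 := hy
    rw [← smul_sub, inner_smul_right] at hy
    simpa [(hgpos y).ne'] using hy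
  · filter_upwards [hu] with y hy
    change 0 ≤ -inner ℝ u (g y • y - g y • x)
    rw [← smul_sub, inner_smul_right]
    simpa using mul_nonpos_of_nonneg_of_nonpos (hgpos y).le hy

theorem convexCore_nonempty (μ : Measure (EuclideanSpace ℝ (Fin d))) [IsFiniteMeasure μ]
    [NeZero μ] : (convexCore μ).Nonempty := by
  obtain ⟨x, hx⟩ := exists_forall_ae_inner_eq_zero μ
  refine ⟨x, mem_convexCore_iff.2 fun C hC hm hae => ?_⟩
  by_contra hxC
  -- Cutting `C` by the a.e. orthogonality relations in `W` keeps full measure. A functional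
  -- properly separating `x` from the cut set would belong to `W` by the choice of `x`, and so
  -- vanish on that set.
  let W : Submodule ℝ (EuclideanSpace ℝ (Fin d)) :=
    { carrier := {u | ∀ᵐ y ∂μ, inner ℝ u (y - x) = 0}
      add_mem' := fun {a b} ha hb => by
        change ∀ᵐ y ∂μ, inner ℝ (a + b) (y - x) = 0
        filter_upwards [ha, hb] with y h₁ h₂
        rw [inner_add_left, h₁, h₂, add_zero]
      zero_mem' := ae_of_all _ fun y => inner_zero_left _
      smul_mem' := fun c u hu => by
        change ∀ᵐ y ∂μ, inner ℝ (c • u) (y - x) = 0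
        filter_upwards [hu] with y h
        rw [inner_smul_left, h, mul_zero] }
  have hW : ∀ᵐ y ∂μ, ∀ u ∈ W, inner ℝ u (y - x) = 0 := by
    obtain ⟨s, hs⟩ := IsNoetherian.noetherian W
    have : ∀ᵐ y ∂μ, ∀ u ∈ (s : Set (EuclideanSpace ℝ (Fin d))), inner ℝ u (y - x) = 0 :=
      (ae_ball_iff s.countable_toSet).2 fun u hu =>
        show u ∈ W from hs ▸ Submodule.subset_span hu
    filter_upwards [this] with y hy u hu
    rw [← hs] at hu
    induction hu using Submodule.span_induction with
    | mem v hv => exact hy v hv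
    | zero => exact inner_zero_left _
    | add v w _ _ hv hw => rw [inner_add_left, hv, hw, add_zero]
    | smul a v _ hv => rw [inner_smul_left, hv, mul_zero]
  set C' : Set (EuclideanSpace ℝ (Fin d)) := C ∩ {y | ∀ u ∈ W, inner ℝ u (y - x) = 0}
  have hC' : Convex ℝ C' := by
    refine hC.inter fun y₁ h₁ y₂ h₂ a b _ _ hab u hu => ?_
    have : a • y₁ + b • y₂ - x = a • (y₁ - x) + b • (y₂ - x) := by
      rw [smul_sub, smul_sub, sub_add_sub_comm, ← add_smul, hab, one_smul]
    rw [this, inner_add_right, inner_smul_right, inner_smul_right, h₁ u hu, h₂ u hu]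
    simp
  have hae' : ∀ᵐ y ∂μ, y ∈ C' := by
    filter_upwards [hae, hW] with y h₁ h₂ using ⟨h₁, h₂⟩
  obtain ⟨y, hy⟩ := hae'.exists
  obtain ⟨u, hu, w, hw, hneg⟩ := exists_inner_nonpos_of_forall_notMem_openSegment hC' hy
    fun c hc hxc => hxC (hC.openSegment_subset hy.1 hc.1 hxc)
  exact hneg.ne (hw.2 u (hx u (hae'.mono fun y hy => hu y hy)))

theorem convexCore_inter_nonempty {μ : Measure (EuclideanSpace ℝ (Fin d))} [IsFiniteMeasure μ]
    {C : Set (EuclideanSpace ℝ (Fin d))} (hC : Convex ℝ C) (hm : MeasurableSet C)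
    (h : μ C ≠ 0) : (convexCore μ ∩ C).Nonempty := by
  have : NeZero (μ.restrict C) := ⟨by rwa [Ne, Measure.restrict_eq_zero]⟩
  obtain ⟨x, hx⟩ := convexCore_nonempty (μ.restrict C)
  exact ⟨x, convexCore_mono Measure.absolutelyContinuous_restrict hx,
    mem_convexCore_iff.1 hx C hC hm (ae_restrict_mem hm)⟩

/-- A ball of positive measure is convex, so it meets the core. -/
theorem ae_mem_closure_convexCore (μ : Measure (EuclideanSpace ℝ (Fin d))) [IsFiniteMeasure μ] :
    ∀ᵐ y ∂μ, y ∈ closure (convexCore μ) := by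
  refine measure_null_of_locally_null _ fun x hx => ?_
  obtain ⟨r, hr, hball⟩ := Metric.isOpen_iff.1 isClosed_closure.isOpen_compl x hx
  refine ⟨_, mem_nhdsWithin_of_mem_nhds (Metric.ball_mem_nhds x hr), ?_⟩
  by_contra h
  obtain ⟨y, hy, hyb⟩ := convexCore_inter_nonempty (convex_ball x r) measurableSet_ball h
  exact hball hyb (subset_closure hy)

/-- A point of the convex core lies in every convex Borel set of almost full measure. -/
theorem exists_forall_mem_of_measure_compl_lt {μ : Measure (EuclideanSpace ℝ (Fin d))}
    [IsFiniteMeasure μ] {x : EuclideanSpace ℝ (Fin d)} (hx : x ∈ convexCore μ) :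
    ∃ δ : ℝ≥0∞, 0 < δ ∧ ∀ C, Convex ℝ C → MeasurableSet C → μ Cᶜ < δ → x ∈ C := by
  by_contra! h
  obtain ⟨ε, hε, hsum⟩ := ENNReal.exists_pos_sum_of_countable' one_ne_zero ℕ
  choose C hC hm hlt hxC using fun n => h (ε n) (hε n)
  -- Borel–Cantelli: the set of points lying in all but finitely many `C n` is convex, Borel and of
  -- full measure, so it contains `x`.
  have hae := ae_eventually_notMem (μ := μ) (s := fun n => (C n)ᶜ)
    ((ENNReal.tsum_le_tsum fun n => (hlt n).le).trans_lt (hsum.trans ENNReal.one_lt_top)).ne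
  simp only [Set.mem_compl_iff, not_not] at hae
  have hmem := mem_convexCore_iff.1 hx {y | ∀ᶠ n in atTop, y ∈ C n} ?_ ?_ hae
  · exact hmem.exists.elim fun n hn => hxC n hn
  · intro y₁ h₁ y₂ h₂ a b ha hb hab
    filter_upwards [h₁, h₂] with n h₁ h₂ using hC n h₁ h₂ ha hb hab
  · simp only [eventually_atTop]
    measurability

theorem convexCore_restrict_subset {μ : Measure (EuclideanSpace ℝ (Fin d))} [IsFiniteMeasure μ]
    {F : Set (EuclideanSpace ℝ (Fin d))} (hF : IsConvexFace (convexCore μ) F) :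
    convexCore (μ.restrict (closure F)) ⊆ F := fun _ hx =>
  hF.2.2.mem_of_mem_closure hF.2.1 (convexCore_mono Measure.absolutelyContinuous_restrict hx)
    (mem_convexCore_iff.1 hx _ hF.2.1.closure measurableSet_closure
      (ae_restrict_mem measurableSet_closure))

/-- Supporting hyperplanes at a relative interior point `x` of `F` cut the space down. In an affine
subspace of least dimension among those that contain `F` and keep the core, the core of the
restricted measure lies in `F`. -/
theorem subset_convexCore_restrict_closure {μ : Measure (EuclideanSpace ℝ (Fin d))}
    [IsFiniteMeasure μ] {F : Set (EuclideanSpace ℝ (Fin d))}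
    (hF : IsConvexFace (convexCore μ) F) : F ⊆ convexCore (μ.restrict (closure F)) := by
  obtain ⟨hne, hconv, hext⟩ := hF
  obtain ⟨x, hx⟩ := Set.Nonempty.intrinsicInterior hconv hne
  let A : Submodule ℝ (EuclideanSpace ℝ (Fin d)) → Set (EuclideanSpace ℝ (Fin d)) :=
    fun V => {y | y - x ∈ V}
  have hAm : ∀ V, MeasurableSet (A V) := fun V =>
    (V.closed_of_finiteDimensional.preimage (continuous_id.sub continuous_const)).measurableSet
  let 𝒱 : Set (Submodule ℝ (EuclideanSpace ℝ (Fin d))) :=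
    {V | F ⊆ A V ∧ convexCore μ ∩ A V ⊆ convexCore (μ.restrict (A V))}
  have htop : ⊤ ∈ 𝒱 := by
    have : A ⊤ = Set.univ := by ext; simp [A]
    simp [𝒱, this]
  obtain ⟨V, ⟨hFV, hV⟩, hmin⟩ := WellFounded.has_min
    (measure fun V : Submodule ℝ (EuclideanSpace ℝ (Fin d)) => Module.finrank ℝ V).wf 𝒱 ⟨_, htop⟩
  set ν := μ.restrict (A V) with hν
  have hνμ : convexCore ν ⊆ convexCore μ := convexCore_mono Measure.absolutelyContinuous_restrict
  have hνF : convexCore ν ⊆ F := by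
    intro y hy
    by_contra hyF
    obtain ⟨u, hu, w, hw, hneg⟩ := exists_inner_nonpos_of_forall_notMem_openSegment
      (x := x) (convex_convexCore ν) hy fun c hc hxc =>
        hyF (hext.2 (hνμ hy) (hνμ hc) (intrinsicInterior_subset hx) hxc)
    have hcomb : ∀ (a b : ℝ) (y₁ y₂ : EuclideanSpace ℝ (Fin d)), a + b = 1 →
        inner ℝ u (a • y₁ + b • y₂ - x) = a * inner ℝ u (y₁ - x) + b * inner ℝ u (y₂ - x) := by
      intro a b y₁ y₂ hab
      rw [← inner_smul_right, ← inner_smul_right, ← inner_add_right, smul_sub, smul_sub,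
        sub_add_sub_comm, ← add_smul, hab, one_smul]
    have hFu : ∀ z ∈ F, inner ℝ u (z - x) = 0 := by
      intro z hz
      obtain ⟨z', hz', a, b, ha, hb, hab, hzx⟩ :=
        exists_mem_openSegment_of_mem_intrinsicInterior hx (subset_affineSpan ℝ F hz)
      have h₁ := hu z (hV ⟨hext.1 hz, hFV hz⟩)
      have h₂ := hu z' (hV ⟨hext.1 hz', hFV hz'⟩)
      have h₃ := hcomb a b z z' hab
      rw [hzx, sub_self, inner_zero_right] at h₃
      nlinarith
    have hAV' : ∀ z, z ∈ A (V ⊓ (Submodule.span ℝ {u})ᗮ) ↔ z ∈ A V ∧ inner ℝ u (z - x) = 0 := by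
      intro z
      simp only [A, Set.mem_ofPred_eq, Submodule.mem_inf,
        Submodule.mem_orthogonal_singleton_iff_inner_right]
    refine hmin (V ⊓ (Submodule.span ℝ {u})ᗮ) ⟨fun z hz => (hAV' z).2 ⟨hFV hz, hFu z hz⟩, ?_⟩ ?_
    · rintro z ⟨hzμ, hzA⟩
      obtain ⟨hzA, hzu⟩ := (hAV' z).1 hzA
      refine mem_convexCore_iff.2 fun C hC hm hae => ?_
      rw [ae_restrict_iff' (hAm _)] at hae
      -- Adjoining the open half-space to the slice of `C` in the hyperplane gives a convex set of
      -- full `ν`-measure; a core point on the hyperplane must lie in the slice.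
      have hzC := mem_convexCore_iff.1 (hV ⟨hzμ, hzA⟩)
        {y | inner ℝ u (y - x) < 0 ∨ inner ℝ u (y - x) = 0 ∧ y ∈ C} ?_ ?_ ?_
      · exact hzC.elim (fun h => absurd hzu h.ne) fun h => h.2
      · rw [convex_iff_forall_pos]
        rintro y₁ h₁ y₂ h₂ a b ha hb hab
        simp only [Set.mem_ofPred_eq] at h₁ h₂ ⊢
        rw [hcomb a b y₁ y₂ hab]
        rcases h₁ with h₁ | ⟨h₁, h₁'⟩ <;> rcases h₂ with h₂ | ⟨h₂, h₂'⟩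
        · left; nlinarith
        · left; rw [h₂]; nlinarith
        · left; rw [h₁]; nlinarith
        · right; exact ⟨by rw [h₁, h₂]; simp, hC h₁' h₂' ha.le hb.le hab⟩
      · have hmu : Measurable fun y : EuclideanSpace ℝ (Fin d) => inner ℝ u (y - x) := by
          fun_prop
        exact (measurableSet_lt hmu measurable_const).union
          ((measurableSet_eq_fun hmu measurable_const).inter hm)
      · have hcl : ∀ᵐ y ∂μ.restrict (A V), inner ℝ u (y - x) ≤ 0 := by
          filter_upwards [ae_mem_closure_convexCore (μ.restrict (A V))] with y hy
          have hclosed : IsClosed {y : EuclideanSpace ℝ (Fin d) | inner ℝ u (y - x) ≤ 0} :=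
            isClosed_le (by fun_prop) continuous_const
          exact closure_minimal (t := {y | inner ℝ u (y - x) ≤ 0}) hu hclosed hy
        filter_upwards [hcl, ae_restrict_of_ae hae, ae_restrict_mem (hAm V)] with y h₁ h₂ h₃
        exact h₁.lt_or_eq.imp_right fun h => ⟨h, h₂ ((hAV' y).2 ⟨h₃, h⟩)⟩
    · refine Submodule.finrank_lt_finrank_of_lt (lt_of_le_of_ne inf_le_left fun heq => ?_)
      have hwA : w ∈ A V := by
        refine mem_convexCore_iff.1 hw (A V) ?_ (hAm V) (ae_restrict_mem (hAm V))
        intro y₁ h₁ y₂ h₂ a b _ _ hab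
        have : a • y₁ + b • y₂ - x = a • (y₁ - x) + b • (y₂ - x) := by
          rw [smul_sub, smul_sub, sub_add_sub_comm, ← add_smul, hab, one_smul]
        simp only [A, Set.mem_ofPred_eq, this]
        exact V.add_mem (V.smul_mem _ h₁) (V.smul_mem _ h₂)
      rw [← heq] at hwA
      exact hneg.ne ((hAV' w).1 hwA).2
  intro z hz
  refine mem_convexCore_iff.2 fun C hC hm hae => ?_
  refine mem_convexCore_iff.1 (hV ⟨hext.1 hz, hFV hz⟩) C hC hm ?_
  rw [ae_restrict_iff' measurableSet_closure] at hae
  filter_upwards [ae_mem_closure_convexCore (μ.restrict (A V)), ae_restrict_of_ae hae] with y h₁ h₂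
  exact h₂ (closure_mono hνF h₁)

end ConvexCore

/-! ### Variation distance, densities and conditioning. -/

section VariationDistance

variable {d : ℕ} {P Q : Measure (EuclideanSpace ℝ (Fin d))} [IsFiniteMeasure P]
  [IsFiniteMeasure Q]

theorem variationDist_ne_top : variationDist P Q ≠ ∞ := measure_ne_top _ _

theorem abs_measureReal_sub_le_variationDist {B : Set (EuclideanSpace ℝ (Fin d))}
    (hB : MeasurableSet B) : |P.real B - Q.real B| ≤ (variationDist P Q).toReal := by
  have h := (P.toSignedMeasure - Q.toSignedMeasure).norm_le_totalVariation B
  rw [Measure.toSignedMeasure_sub_apply hB, Real.norm_eq_abs] at h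
  exact h.trans (measureReal_mono (Set.subset_univ B))

theorem measure_le_variationDist {B : Set (EuclideanSpace ℝ (Fin d))} (hB : MeasurableSet B)
    (hP : P B = 0) : Q B ≤ variationDist P Q := by
  have h := abs_measureReal_sub_le_variationDist (P := P) (Q := Q) hB
  rw [measureReal_def, hP, ENNReal.toReal_zero, zero_sub, abs_neg, abs_of_nonneg measureReal_nonneg]
    at h
  exact (ENNReal.toReal_le_toReal (measure_ne_top _ _) variationDist_ne_top).1 h

/-- The factor 2 comes from the two halves of a Hahn decomposition. -/
theorem variationDist_le_of_forall {ε : ℝ}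
    (h : ∀ B, MeasurableSet B → |P.real B - Q.real B| ≤ ε) :
    variationDist P Q ≤ ENNReal.ofReal (2 * ε) := by
  set s := P.toSignedMeasure - Q.toSignedMeasure with hs
  obtain ⟨S, hS, -, -, hpos, hneg⟩ := s.toJordanDecomposition.exists_compl_positive_negative
  have h₁ := s.apply_eq_posPart_real_sub_negPart_real hS
  have h₂ := s.apply_eq_posPart_real_sub_negPart_real hS.compl
  rw [hs, Measure.toSignedMeasure_sub_apply hS, ← hs] at h₁
  rw [hs, Measure.toSignedMeasure_sub_apply hS.compl, ← hs] at h₂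
  have hp : s.toJordanDecomposition.posPart.real S = 0 := by simp [measureReal_def, hpos]
  have hn : s.toJordanDecomposition.negPart.real Sᶜ = 0 := by simp [measureReal_def, hneg]
  have h₃ := neg_abs_le (P.real S - Q.real S)
  have h₄ := le_abs_self (P.real Sᶜ - Q.real Sᶜ)
  have h₅ := h S hS
  have h₆ := h Sᶜ hS.compl
  have hsum : (variationDist P Q).toReal = s.toJordanDecomposition.posPart.real Sᶜ +
      s.toJordanDecomposition.negPart.real S := by
    change s.totalVariation.real Set.univ = _
    rw [SignedMeasure.totalVariation, measureReal_add_apply,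
      ← measureReal_add_measureReal_compl (μ := s.toJordanDecomposition.posPart) hS,
      ← measureReal_add_measureReal_compl (μ := s.toJordanDecomposition.negPart) hS, hp, hn]
    ring
  rw [← ENNReal.ofReal_toReal (variationDist_ne_top (P := P) (Q := Q)), hsum]
  exact ENNReal.ofReal_le_ofReal (by linarith)

theorem absolutelyContinuous_of_tendsto_variationDist
    {R : ℕ → Measure (EuclideanSpace ℝ (Fin d))} [∀ n, IsFiniteMeasure (R n)]
    {ν : Measure (EuclideanSpace ℝ (Fin d))} (hR : ∀ n, R n ≪ ν)
    (h : Tendsto (fun n => variationDist (R n) P) atTop (𝓝 0)) : P ≪ ν := by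
  refine Measure.AbsolutelyContinuous.mk fun B hB hν => ?_
  exact le_antisymm (ge_of_tendsto' h fun n => measure_le_variationDist hB (hR n hν)) zero_le

theorem integral_abs_toReal_rnDeriv_sub_le {ν : Measure (EuclideanSpace ℝ (Fin d))}
    [SigmaFinite ν] (hP : P ≪ ν) (hQ : Q ≪ ν) :
    ∫ y, |(P.rnDeriv ν y).toReal - (Q.rnDeriv ν y).toReal| ∂ν ≤
      2 * (variationDist P Q).toReal := by
  have hPi : Integrable (fun y => (P.rnDeriv ν y).toReal) ν := Measure.integrable_toReal_rnDeriv
  have hQi : Integrable (fun y => (Q.rnDeriv ν y).toReal) ν := Measure.integrable_toReal_rnDeriv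
  set B := {y | (P.rnDeriv ν y).toReal ≤ (Q.rnDeriv ν y).toReal}
  have hB : MeasurableSet B := measurableSet_le (Measure.measurable_rnDeriv _ _).ennreal_toReal
    (Measure.measurable_rnDeriv _ _).ennreal_toReal
  have hset : ∀ s, ∫ y in s, ((P.rnDeriv ν y).toReal - (Q.rnDeriv ν y).toReal) ∂ν =
      P.real s - Q.real s := fun s => by
    rw [integral_sub hPi.integrableOn hQi.integrableOn, Measure.setIntegral_toReal_rnDeriv hP,
      Measure.setIntegral_toReal_rnDeriv hQ]
  have h₁ : ∫ y in B, |(P.rnDeriv ν y).toReal - (Q.rnDeriv ν y).toReal| ∂ν =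
      -(P.real B - Q.real B) := by
    rw [← hset, ← integral_neg]
    exact setIntegral_congr_fun hB fun y hy => abs_of_nonpos (sub_nonpos.2 hy)
  have h₂ : ∫ y in Bᶜ, |(P.rnDeriv ν y).toReal - (Q.rnDeriv ν y).toReal| ∂ν =
      P.real Bᶜ - Q.real Bᶜ := by
    rw [← hset]
    exact setIntegral_congr_fun hB.compl fun y hy =>
      abs_of_nonneg (sub_nonneg.2 (le_of_not_ge fun h => hy h))
  have h₇ := integral_add_compl hB (hPi.sub hQi).abs
  have h₃ := abs_measureReal_sub_le_variationDist (P := P) (Q := Q) hB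
  have h₄ := abs_measureReal_sub_le_variationDist (P := P) (Q := Q) hB.compl
  have h₅ := neg_abs_le (P.real B - Q.real B)
  have h₆ := le_abs_self (P.real Bᶜ - Q.real Bᶜ)
  simp only [Pi.sub_apply] at h₇
  rw [← h₇, h₁, h₂]
  linarith

theorem exists_subseq_ae_tendsto_rnDeriv {R : ℕ → Measure (EuclideanSpace ℝ (Fin d))}
    [∀ n, IsFiniteMeasure (R n)] {ν : Measure (EuclideanSpace ℝ (Fin d))} [SigmaFinite ν]
    (hR : ∀ n, R n ≪ ν) (h : Tendsto (fun n => variationDist (R n) P) atTop (𝓝 0)) :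
    ∃ ns : ℕ → ℕ, StrictMono ns ∧ ∀ᵐ y ∂ν,
      Tendsto (fun k => ((R (ns k)).rnDeriv ν y).toReal) atTop (𝓝 (P.rnDeriv ν y).toReal) := by
  have hP : P ≪ ν := absolutelyContinuous_of_tendsto_variationDist hR h
  refine TendstoInMeasure.exists_seq_tendsto_ae
    (tendstoInMeasure_of_tendsto_eLpNorm one_ne_zero
      (fun n => (Measure.measurable_rnDeriv _ _).ennreal_toReal.aestronglyMeasurable)
      (Measure.measurable_rnDeriv _ _).ennreal_toReal.aestronglyMeasurable ?_)
  have h2 : Tendsto (fun n => ENNReal.ofReal (2 * (variationDist (R n) P).toReal)) atTop (𝓝 0) := by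
    have := ENNReal.tendsto_ofReal
      (((ENNReal.tendsto_toReal ENNReal.zero_ne_top).comp h).const_mul 2)
    simpa using this
  refine tendsto_of_tendsto_of_tendsto_of_le_of_le tendsto_const_nhds h2 (fun _ => zero_le)
    fun n => ?_
  have hi : Integrable (fun y => ((R n).rnDeriv ν y).toReal - (P.rnDeriv ν y).toReal) ν :=
    Measure.integrable_toReal_rnDeriv.sub Measure.integrable_toReal_rnDeriv
  have := ENNReal.ofReal_le_ofReal (integral_abs_toReal_rnDeriv_sub_le (hR n) hP)
  refine le_trans (le_of_eq ?_) this
  rw [eLpNorm_one_eq_lintegral_enorm]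
  exact (ofReal_integral_norm_eq_lintegral_enorm hi).symm

theorem variationDist_cond_le [IsProbabilityMeasure P] [IsProbabilityMeasure Q]
    {s : Set (EuclideanSpace ℝ (Fin d))} (hs : MeasurableSet s) (hP : P.real s = 1)
    (h : (variationDist Q P).toReal ≤ 1 / 2) :
    variationDist (cond Q s) P ≤ ENNReal.ofReal (2 * (4 * (variationDist Q P).toReal)) := by
  refine variationDist_le_of_forall fun B hB => ?_
  set t := (variationDist Q P).toReal
  have hq := abs_measureReal_sub_le_variationDist (P := Q) (Q := P) hs
  have hB' := abs_measureReal_sub_le_variationDist (P := Q) (Q := P) (hs.inter hB)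
  have hPB : P.real B = P.real (s ∩ B) := by
    have h₁ := measureReal_inter_add_sdiff (μ := P) (s := B) hs
    have h₂ : P.real (B \ s) = 0 := by
      have h₃ := prob_compl_eq_zero_iff (μ := P) hs
      have h₄ : P s = 1 := by
        rw [← ofReal_measureReal, hP, ENNReal.ofReal_one]
      rw [measureReal_def, measure_mono_null (fun y hy => hy.2) (h₃.2 h₄), ENNReal.toReal_zero]
    rw [Set.inter_comm]
    linarith
  have hle : Q.real (s ∩ B) ≤ Q.real s := measureReal_mono Set.inter_subset_left
  have h0 : 0 ≤ Q.real (s ∩ B) := measureReal_nonneg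
  have hq1 : Q.real s ≤ 1 := measureReal_le_one
  rw [hP] at hq
  rw [abs_le] at hq hB'
  have hqpos : 0 < Q.real s := by linarith
  rw [hPB, measureReal_def, cond_apply hs, ENNReal.toReal_mul, ENNReal.toReal_inv,
    ← measureReal_def, ← measureReal_def]
  -- Normalising changes the mass by at most `1 - Q.real s ≤ t`; the constants here and in the
  -- conclusion are not sharp.
  have key : |(Q.real s)⁻¹ * Q.real (s ∩ B) - Q.real (s ∩ B)| ≤ 2 * t := by
    have h₁ : (Q.real s)⁻¹ * Q.real (s ∩ B) - Q.real (s ∩ B) =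
        (1 - Q.real s) * ((Q.real s)⁻¹ * Q.real (s ∩ B)) := by field_simp
    have h₂ : (Q.real s)⁻¹ * Q.real (s ∩ B) ≤ 1 := by
      rw [inv_mul_le_iff₀ hqpos]; linarith
    have h₃ : 0 ≤ (Q.real s)⁻¹ * Q.real (s ∩ B) := by positivity
    rw [h₁, abs_of_nonneg (mul_nonneg (by linarith) h₃)]
    nlinarith
  rw [abs_le] at key ⊢
  constructor <;> linarith

end VariationDistance

/-! ### Conditioning a tilted measure. -/

section Tilted

variable {α : Type*} {mα : MeasurableSpace α}

theorem cond_tilted {ν : Measure α} {f : α → ℝ} (hf : Integrable (fun x => Real.exp (f x)) ν)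
    {s : Set α} (hs : MeasurableSet s) (hνs : ν s ≠ 0) :
    cond (ν.tilted f) s = (ν.restrict s).tilted f := by
  have : NeZero (ν.restrict s) := ⟨by rwa [Ne, Measure.restrict_eq_zero]⟩
  have : NeZero ν := ⟨fun h => hνs (by simp [h])⟩
  have hZ : 0 < ∫ x, Real.exp (f x) ∂ν := integral_exp_pos hf
  have hZs : 0 < ∫ x in s, Real.exp (f x) ∂ν := integral_exp_pos hf.restrict
  rw [ProbabilityTheory.cond, tilted_apply_eq_ofReal_integral' f hs, integral_div, Measure.tilted, Measure.tilted,
    restrict_withDensity hs, ← withDensity_smul', ← ENNReal.ofReal_inv_of_pos (by positivity)]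
  · congr with x
    rw [Pi.smul_apply, smul_eq_mul, ← ENNReal.ofReal_mul (by positivity)]
    congr 1
    field_simp
  · simp [hZ, hZs]

end Tilted

/-! ### Limits within one exponential family. -/

section ExpFamily

variable {d : ℕ}

/-- A pointwise limit of linear functionals, on a set where they converge up to constants, is given
by an inner product. -/
theorem exists_tendsto_inner_sub {θ : ℕ → EuclideanSpace ℝ (Fin d)}
    {F : Set (EuclideanSpace ℝ (Fin d))} {x : EuclideanSpace ℝ (Fin d)}
    (h : ∀ y ∈ F, ∃ l, Tendsto (fun n => inner ℝ (θ n) (y - x)) atTop (𝓝 l)) :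
    ∃ ϑ : EuclideanSpace ℝ (Fin d), ∀ y ∈ closure F,
      Tendsto (fun n => inner ℝ (θ n) (y - x)) atTop (𝓝 (inner ℝ ϑ (y - x))) := by
  -- The directions of convergence form a subspace, closed by finite dimension, so convergence
  -- passes from `F` to its closure.
  let V : Submodule ℝ (EuclideanSpace ℝ (Fin d)) :=
    { carrier := {v | ∃ l, Tendsto (fun n => inner ℝ (θ n) v) atTop (𝓝 l)}
      add_mem' := fun {a b} ⟨l, hl⟩ ⟨m, hm⟩ => ⟨l + m, by
        simp only [inner_add_right]; exact hl.add hm⟩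
      zero_mem' := ⟨0, by simp⟩
      smul_mem' := fun c v ⟨l, hl⟩ => ⟨c * l, by
        simp only [inner_smul_right]; exact hl.const_mul c⟩ }
  have hFV : closure F ⊆ {y | y - x ∈ V} :=
    closure_minimal (fun y hy => h y hy)
      (V.closed_of_finiteDimensional.preimage (continuous_id.sub continuous_const))
  choose f hf using fun v : V => v.2
  let g : V →ₗ[ℝ] ℝ := linearMapOfTendsto f
    (fun n => (innerₛₗ ℝ (θ n)).comp V.subtype) (l := atTop) (tendsto_pi_nhds.2 hf)
  obtain ⟨G, hG⟩ := LinearMap.exists_extend g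
  obtain ⟨ϑ, hϑ⟩ := (InnerProductSpace.toDual ℝ _).surjective (LinearMap.toContinuousLinearMap G)
  refine ⟨ϑ, fun y hy => ?_⟩
  have h₁ : inner ℝ ϑ (y - x) = f ⟨y - x, hFV hy⟩ := by
    have h₂ : InnerProductSpace.toDual ℝ _ ϑ (y - x) = G (y - x) := by rw [hϑ]; rfl
    rw [InnerProductSpace.toDual_apply_apply] at h₂
    rw [h₂]
    exact LinearMap.congr_fun hG ⟨y - x, hFV hy⟩
  rw [h₁]
  exact hf ⟨y - x, hFV hy⟩

/-- A limit in variation `P` of members of the exponential family based on `ν` belongs to the family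
if the core of `P` meets `F`, a subset of the core of `ν` with `ν`-full closure, in a point at which
`F` is its own smallest face. -/
theorem mem_expFamily_of_tendsto_variationDist {ν P : Measure (EuclideanSpace ℝ (Fin d))}
    [IsFiniteMeasure ν] [IsProbabilityMeasure P] {R : ℕ → Measure (EuclideanSpace ℝ (Fin d))}
    [∀ n, IsProbabilityMeasure (R n)] (hR : ∀ n, R n ∈ expFamily ν)
    (hconv : Tendsto (fun n => variationDist (R n) P) atTop (𝓝 0))
    {F : Set (EuclideanSpace ℝ (Fin d))} (hF : Convex ℝ F) (hFν : F ⊆ convexCore ν)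
    (hνF : ∀ᵐ y ∂ν, y ∈ closure F) {x : EuclideanSpace ℝ (Fin d)} (hxF : x ∈ F)
    (hxP : x ∈ convexCore P)
    (hmin : ∀ G, IsExtreme ℝ F G → Convex ℝ G → x ∈ G → F ⊆ G) : P ∈ expFamily ν := by
  choose θ hθ hRθ using hR
  have hRν : ∀ n, R n ≪ ν := fun n => by
    rw [hRθ n]; exact tilted_absolutelyContinuous _ _
  have hPν : P ≪ ν := absolutelyContinuous_of_tendsto_variationDist hRν hconv
  have : NeZero ν := ⟨fun h => NeZero.ne P (Measure.absolutelyContinuous_zero_iff.1 (h ▸ hPν))⟩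
  have : P.HaveLebesgueDecomposition ν := Measure.haveLebesgueDecomposition_of_sigmaFinite P ν
  obtain ⟨ns, -, hns⟩ := exists_subseq_ae_tendsto_rnDeriv hRν hconv
  set L : ℕ → EuclideanSpace ℝ (Fin d) → ℝ := fun k y => inner ℝ (θ (ns k)) y -
    Real.log (∫ z, Real.exp (inner ℝ (θ (ns k)) z) ∂ν) with hL
  have hLm : ∀ k, Measurable (L k) := fun k => by fun_prop
  have hLcomb : ∀ k (a b : ℝ) (y₁ y₂ : EuclideanSpace ℝ (Fin d)), a + b = 1 →
      L k (a • y₁ + b • y₂) = L k y₁ * a + L k y₂ * b := by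
    intro k a b y₁ y₂ hab
    obtain rfl : b = 1 - a := by linarith
    simp only [hL, inner_add_right, inner_smul_right]
    ring
  have hdens : ∀ᵐ y ∂ν, Tendsto (fun k => Real.exp (L k y)) atTop
      (𝓝 (P.rnDeriv ν y).toReal) := by
    have h₁ : ∀ᵐ y ∂ν, ∀ k, ((R (ns k)).rnDeriv ν y).toReal = Real.exp (L k y) := by
      refine ae_all_iff.2 fun k => ?_
      rw [hRθ (ns k)]
      filter_upwards [rnDeriv_tilted_left_self (μ := ν)
        (f := fun y => inner ℝ (θ (ns k)) y) (by fun_prop)] with y hy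
      have hZ := integral_exp_pos (hθ (ns k))
      rw [hy, ENNReal.toReal_ofReal (by positivity), hL, Real.exp_sub, Real.exp_log hZ]
    filter_upwards [hns, h₁] with y hy h₁
    simpa only [h₁] using hy
  -- In `D` the limit 0 is allowed; in `S` the logarithms themselves converge.
  set D : Set (EuclideanSpace ℝ (Fin d)) :=
    {y | ∃ l, Tendsto (fun k => Real.exp (L k y)) atTop (𝓝 l)}
  set S : Set (EuclideanSpace ℝ (Fin d)) := {y | ∃ l, Tendsto (fun k => L k y) atTop (𝓝 l)}
  have hcombD : ∀ (a b : ℝ) (y₁ y₂ : EuclideanSpace ℝ (Fin d)) (l₁ l₂ : ℝ), 0 ≤ a → 0 ≤ b →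
      a + b = 1 → Tendsto (fun k => Real.exp (L k y₁)) atTop (𝓝 l₁) →
      Tendsto (fun k => Real.exp (L k y₂)) atTop (𝓝 l₂) →
      Tendsto (fun k => Real.exp (L k (a • y₁ + b • y₂))) atTop (𝓝 (l₁ ^ a * l₂ ^ b)) := by
    intro a b y₁ y₂ l₁ l₂ ha hb hab h₁ h₂
    simp only [hLcomb _ a b y₁ y₂ hab, Real.exp_add, Real.exp_mul]
    exact (h₁.rpow_const (Or.inr ha)).mul (h₂.rpow_const (Or.inr hb))
  have hD : Convex ℝ D := fun y₁ ⟨l₁, h₁⟩ y₂ ⟨l₂, h₂⟩ a b ha hb hab =>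
    ⟨_, hcombD a b y₁ y₂ l₁ l₂ ha hb hab h₁ h₂⟩
  have hS : Convex ℝ S := by
    rintro y₁ ⟨l₁, h₁⟩ y₂ ⟨l₂, h₂⟩ a b - - hab
    refine ⟨l₁ * a + l₂ * b, ?_⟩
    simp only [hLcomb _ a b y₁ y₂ hab]
    exact (h₁.mul_const a).add (h₂.mul_const b)
  have hmemS : ∀ y l, Tendsto (fun k => Real.exp (L k y)) atTop (𝓝 l) → l ≠ 0 → y ∈ S := by
    intro y l hl h0
    refine ⟨Real.log l, ?_⟩
    simpa using hl.log h0
  have hSD : IsExtreme ℝ D S := by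
    refine ⟨fun y ⟨l, hl⟩ => ⟨_, (Real.continuous_exp.tendsto l).comp hl⟩, ?_⟩
    rintro y₁ ⟨l₁, h₁⟩ y₂ ⟨l₂, h₂⟩ z ⟨l, hl⟩ ⟨a, b, ha, hb, hab, rfl⟩
    -- A weighted geometric mean with positive weights is nonzero only if both limits are.
    have h₃ := tendsto_nhds_unique ((Real.continuous_exp.tendsto l).comp hl)
      (hcombD a b y₁ y₂ l₁ l₂ ha.le hb.le hab h₁ h₂)
    refine hmemS y₁ l₁ h₁ fun h0 => (Real.exp_pos l).ne' ?_
    rw [h₃, h0, Real.zero_rpow ha.ne', zero_mul]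
  have hFD : F ⊆ D := fun y hy => mem_convexCore_iff.1 (hFν hy) D hD
    (measurableSet_exists_tendsto fun k => (hLm k).exp) (hdens.mono fun y hy => ⟨_, hy⟩)
  -- The limit density is positive `P`-a.e., so `S` has full `P`-measure.
  have hxS : x ∈ S := by
    refine mem_convexCore_iff.1 hxP S hS (measurableSet_exists_tendsto hLm) ?_
    filter_upwards [hPν.ae_le hdens, Measure.rnDeriv_pos hPν,
      hPν.ae_le (Measure.rnDeriv_lt_top P ν)] with y h₁ h₂ h₃
    exact hmemS y _ h₁ (ENNReal.toReal_pos h₂.ne' h₃.ne).ne'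
  have hFS : F ⊆ S := by
    refine (hmin (F ∩ S) ⟨Set.inter_subset_left, ?_⟩ (hF.inter hS) ⟨hxF, hxS⟩).trans
      Set.inter_subset_right
    exact fun y₁ h₁ y₂ h₂ z hz hzy => ⟨h₁, hSD.2 (hFD h₁) (hFD h₂) hz.2 hzy⟩
  obtain ⟨l, hl⟩ := hxS
  have hsub : ∀ k y, inner ℝ (θ (ns k)) (y - x) = L k y - L k x := fun k y => by
    simp only [hL, inner_sub_right]; ring
  obtain ⟨ϑ, hϑ⟩ := exists_tendsto_inner_sub (θ := fun k => θ (ns k)) (F := F) (x := x)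
    fun y hy => by
      obtain ⟨m, hm⟩ := hFS hy
      exact ⟨m - l, by simpa only [hsub] using hm.sub hl⟩
  set K : ℝ := Real.exp (l - inner ℝ ϑ x) with hK
  have hK0 : 0 < K := Real.exp_pos _
  have hp : ∀ᵐ y ∂ν, (P.rnDeriv ν y).toReal = K * Real.exp (inner ℝ ϑ y) := by
    filter_upwards [hdens, hνF] with y h₁ h₂
    have h₃ := (Real.continuous_exp.tendsto _).comp ((hϑ y h₂).add hl)
    simp only [hsub, Function.comp_def, sub_add_cancel] at h₃
    rw [tendsto_nhds_unique h₁ h₃, hK, ← Real.exp_add, inner_sub_right]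
    ring_nf
  have hint : Integrable (fun y => Real.exp (inner ℝ ϑ y)) ν := by
    have h₁ : Integrable (fun y => (P.rnDeriv ν y).toReal) ν := Measure.integrable_toReal_rnDeriv
    have h₂ := (h₁.congr hp).const_mul K⁻¹
    simpa only [inv_mul_cancel_left₀ hK0.ne'] using h₂
  have hone : K * ∫ y, Real.exp (inner ℝ ϑ y) ∂ν = 1 := by
    rw [← integral_const_mul, ← integral_congr_ae hp, Measure.integral_toReal_rnDeriv hPν,
      probReal_univ]
  refine ⟨ϑ, hint, ?_⟩
  rw [Measure.tilted, ← Measure.withDensity_rnDeriv_eq P ν hPν]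
  refine withDensity_congr_ae ?_
  filter_upwards [hp, Measure.rnDeriv_lt_top P ν] with y h₁ h₂
  rw [← ENNReal.ofReal_toReal h₂.ne, h₁]
  congr 1
  rw [eq_div_iff (by rintro h; rw [h, mul_zero] at hone; exact zero_ne_one hone), mul_right_comm,
    hone, one_mul]

theorem cond_mem_expComponent {μ Q : Measure (EuclideanSpace ℝ (Fin d))}
    {F G : Set (EuclideanSpace ℝ (Fin d))} (hQ : Q ∈ expComponent μ G) (hFG : F ⊆ G)
    (h : Q (closure F) ≠ 0) : cond Q (closure F) ∈ expComponent μ F := by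
  obtain ⟨θ, hθ, rfl⟩ := hQ
  have hres : (μ.restrict (closure G)).restrict (closure F) = μ.restrict (closure F) :=
    Measure.restrict_restrict_of_subset (closure_mono hFG)
  refine ⟨θ, hres ▸ hθ.restrict, ?_⟩
  rw [cond_tilted hθ measurableSet_closure fun h0 => h (tilted_absolutelyContinuous _ _ h0), hres]

end ExpFamily

/-! ### The limit theorem for the extension. -/

theorem theorem4 {d : ℕ} (μ : Measure (EuclideanSpace ℝ (Fin d))) [IsFiniteMeasure μ]
    (hμ : μ ≠ 0)
    (Q : ℕ → Measure (EuclideanSpace ℝ (Fin d))) [∀ n, IsProbabilityMeasure (Q n)]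
    (P : Measure (EuclideanSpace ℝ (Fin d))) [IsProbabilityMeasure P]
    (hQ : ∀ n, Q n ∈ expExtension μ)
    (hconv : Tendsto (fun n => variationDist (Q n) P) atTop (𝓝 0)) :
    ∃ F : Set (EuclideanSpace ℝ (Fin d)),
      IsConvexFace (convexCore μ) F ∧
      P ∈ expComponent μ F ∧
      (∀ᶠ n in atTop, ∀ G : Set (EuclideanSpace ℝ (Fin d)),
        IsConvexFace (convexCore μ) G → Q n ∈ expComponent μ G → F ⊆ G) ∧
      (∀ᶠ n in atTop, Q n (closure F) ≠ 0 ∧ cond (Q n) (closure F) ∈ expComponent μ F) ∧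
      Tendsto (fun n => variationDist (cond (Q n) (closure F)) P) atTop (𝓝 0) := by
  have hcomp : ∀ n G, Q n ∈ expComponent μ G → Q n ≪ μ.restrict (closure G) := by
    rintro n G ⟨θ, -, hθ⟩
    rw [hθ]
    exact tilted_absolutelyContinuous _ _
  have hPμ : P ≪ μ := absolutelyContinuous_of_tendsto_variationDist (fun n => by
    obtain ⟨G, -, hG⟩ := hQ n
    exact (hcomp n G hG).trans Measure.absolutelyContinuous_restrict) hconv
  obtain ⟨x, hx⟩ := Set.Nonempty.intrinsicInterior (convex_convexCore P) (convexCore_nonempty P)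
  have hxP : x ∈ convexCore P := intrinsicInterior_subset hx
  have hxμ : x ∈ convexCore μ := convexCore_mono hPμ hxP
  set F : Set (EuclideanSpace ℝ (Fin d)) := ⋂₀ {G | IsConvexFace (convexCore μ) G ∧ x ∈ G}
  have hxF : x ∈ F := Set.mem_sInter.2 fun G hG => hG.2
  have hFmin : ∀ G, IsConvexFace (convexCore μ) G → x ∈ G → F ⊆ G := fun G hG hxG =>
    Set.sInter_subset_of_mem ⟨hG, hxG⟩
  have hF : IsConvexFace (convexCore μ) F :=
    ⟨⟨x, hxF⟩, convex_sInter fun G hG => hG.1.2.1, isExtreme_sInter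
      ⟨convexCore μ, ⟨⟨x, hxμ⟩, convex_convexCore μ, IsExtreme.rfl⟩, hxμ⟩ fun G hG => hG.1.2.2⟩
  have hPF : ∀ᵐ y ∂P, y ∈ closure F := by
    filter_upwards [ae_mem_closure_convexCore P] with y hy
    refine closure_mono (fun z hz => ?_) hy
    obtain ⟨z', hz', hxz⟩ :=
      exists_mem_openSegment_of_mem_intrinsicInterior hx (subset_affineSpan ℝ _ hz)
    exact hF.2.2.2 (convexCore_mono hPμ hz) (convexCore_mono hPμ hz') hxF hxz
  have hPF1 : P.real (closure F) = 1 := by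
    rw [measureReal_def, (mem_ae_iff_prob_eq_one measurableSet_closure).1 hPF, ENNReal.toReal_one]
  obtain ⟨δ, hδ, hxδ⟩ := exists_forall_mem_of_measure_compl_lt hxP
  have hsub : ∀ᶠ n in atTop, ∀ G : Set (EuclideanSpace ℝ (Fin d)),
      IsConvexFace (convexCore μ) G → Q n ∈ expComponent μ G → F ⊆ G := by
    filter_upwards [hconv.eventually_lt_const hδ] with n hn G hG hQG
    -- A convex set of full measure on `closure G` is `Q n`-full, so its complement has `P`-measure
    -- below `δ`, a bound independent of the set.
    refine hFmin G hG (convexCore_restrict_subset hG (mem_convexCore_iff.2 fun C hC hm hae => ?_))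
    exact hxδ C hC hm
      ((measure_le_variationDist hm.compl (hcomp n G hQG hae)).trans_lt hn)
  have hhalf : ∀ᶠ n in atTop, (variationDist (Q n) P).toReal < 1 / 2 :=
    ((ENNReal.tendsto_toReal ENNReal.zero_ne_top).comp hconv).eventually_lt_const (by norm_num)
  have hpos : ∀ᶠ n in atTop, Q n (closure F) ≠ 0 := by
    filter_upwards [hhalf] with n hn h0
    have h₁ := abs_measureReal_sub_le_variationDist (P := Q n) (Q := P)
      (measurableSet_closure (s := F))
    rw [hPF1, measureReal_def, h0, ENNReal.toReal_zero, zero_sub, abs_neg, abs_one] at h₁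
    linarith
  have hmem : ∀ᶠ n in atTop, Q n (closure F) ≠ 0 ∧
      cond (Q n) (closure F) ∈ expComponent μ F := by
    filter_upwards [hsub, hpos] with n h₁ h₂
    obtain ⟨G, hG, hQG⟩ := hQ n
    exact ⟨h₂, cond_mem_expComponent hQG (h₁ G hG hQG) h₂⟩
  have htend : Tendsto (fun n => variationDist (cond (Q n) (closure F)) P) atTop (𝓝 0) := by
    have h₁ : Tendsto (fun n => ENNReal.ofReal (2 * (4 * (variationDist (Q n) P).toReal))) atTop
        (𝓝 0) := by
      have := ENNReal.tendsto_ofReal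
        ((((ENNReal.tendsto_toReal ENNReal.zero_ne_top).comp hconv).const_mul 4).const_mul 2)
      simpa using this
    refine tendsto_of_tendsto_of_tendsto_of_le_of_le' tendsto_const_nhds h₁
      (Eventually.of_forall fun _ => zero_le) ?_
    filter_upwards [hhalf] with n hn
    exact variationDist_cond_le measurableSet_closure hPF1 hn.le
  refine ⟨F, hF, ?_, hsub, hmem, htend⟩
  -- The shift by `N` drops the terms for which conditioning may be degenerate or leave the
  -- component.
  obtain ⟨N, hN⟩ := eventually_atTop.1 hmem
  have : ∀ k, IsProbabilityMeasure (cond (Q (k + N)) (closure F)) := fun k =>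
    cond_isProbabilityMeasure (hN _ (Nat.le_add_left N k)).1
  exact mem_expFamily_of_tendsto_variationDist
    (R := fun k => cond (Q (k + N)) (closure F))
    (fun k => (hN _ (Nat.le_add_left N k)).2) ((tendsto_add_atTop_iff_nat N).2 htend) hF.2.1
    (subset_convexCore_restrict_closure hF) (ae_restrict_mem measurableSet_closure) hxF hxP
    fun G hG hGc hxG => hFmin G ⟨⟨x, hxG⟩, hGc, hF.2.2.trans hG⟩ hxG
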